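/- Let $\mathcal{A}$ be a non-empty set of action names, let $\overline{\mathcal{A}}=\{\overline a\mid a\in\mathcal A\}$ be the disjoint set of co-names (with $\overline{\overline a}=a$), and let $\mathcal{A}_\tau=\mathcal{A}\cup\overline{\mathcal{A}}\cup\{\tau\}$. CCS terms are given by $$t ::= \mathbf{0}\mid x\mid \mu.t\mid t+t\mid t\parallel t,$$ with $x$ in a countably infinite set of variables and $\mu\in\mathcal{A}_\tau$; terms are identified up to associativity and commutativity of $+$, and processes are closed terms. Transitions between processes are those derivable from the rules: $\mu.p\xrightarrow{\mu}p$; if $p\xrightarrow{\mu}p'$ then $p+q\xrightarrow{\mu}p'$, $q+p\xrightarrow{\mu}p'$, $p\parallel q\xrightarrow{\mu}p'\parallel q$ and $q\parallel p\xrightarrow{\mu}q\parallel p'$; if $p\xrightarrow{\alpha}p'$ and $q\xrightarrow{\overline\alpha}q'$ with $\alpha\in\mathcal{A}\cup\overline{\mathcal{A}}$, then $p\parallel q\xrightarrow{\tau}p'\parallel q'$. Let $\xrightarrow{\varepsilon}$ be the reflexive and transitive closure of $\xrightarrow{\tau}$. Weak bisimilarity $\sim_{\mathtt{WB}}$ is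 the largest symmetric relation on processes such that, whenever $p\sim_{\mathtt{WB}}q$ and $p\xrightarrow{\mu}p'$, there is $q'$ with $p'\sim_{\mathtt{WB}}q'$ and either $\mu=\tau$ and $q\xrightarrow{\varepsilon}q'$, or $\mu\neq\tau$ and $q\xrightarrow{\varepsilon}\xrightarrow{\mu}\xrightarrow{\varepsilon}q'$. Processes $p,q$ are rooted weakly bisimilar, $p\sim_{\mathtt{RWB}}q$, if for every $p\xrightarrow{\mu}p'$ (including $\mu=\tau$) there is $q'$ with $q\xrightarrow{\varepsilon}\xrightarrow{\mu}\xrightarrow{\varepsilon}q'$ and $p'\sim_{\mathtt{WB}}q'$, and symmetrically with $p$ and $q$ exchanged. An equation $t\approx u$ is sound modulo $\sim_{\mathtt{RWB}}$ if $\sigma(t)\sim_{\mathtt{RWB}}\sigma(u)$ for every closed substitution $\sigma$, and a set of equations (an axiom system) is sound if all of its members are. Write $\mathcal{E}\vdash t\approx u$ if $t\approx u$ is derivable from $\mathcal{E}$ by equational logic, i.e. by reflexivity, symmetry, transitivity, substitution, and congruence for $\mu.(\cdot)$, $+$ and $\parallel$. For $n\ge1$ let $M_n$ be the equation $$(x+y)\parallel\sum_{i=1}^n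 z_i+\sum_{i=1}^n\bigl(x\parallel z_i+y\parallel z_i\bigr)\;\approx\; x\parallel\sum_{i=1}^n z_i+y\parallel\sum_{i=1}^n z_i+\sum_{i=1}^n\bigl((x+y)\parallel z_i\bigr),$$ where $x,y,z_1,z_2,\dots$ are pairwise distinct variables. Theorem. If $\mathcal{E}$ is a finite axiom system over CCS that is sound modulo $\sim_{\mathtt{RWB}}$, then there is some $n\ge1$ such that $\mathcal{E}\not\vdash M_n$. -/

import Mathlib

namespace CCS

/-- Visible actions: names `a` and co-names `ā`, for `a` in the set `A` of action names. -/
inductive Label (A : Type*) where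
  | name (a : A) : Label A
  | coname (a : A) : Label A

/-- Complementation of visible actions. -/
def Label.bar {A : Type*} : Label A → Label A
  | .name a => .coname a
  | .coname a => .name a

theorem Label.bar_bar {A : Type*} (α : Label A) : α.bar.bar = α := by
  cases α <;> rfl

theorem Label.bar_ne {A : Type*} (α : Label A) : α.bar ≠ α := by
  cases α <;> simp [Label.bar]

/-- Actions: visible actions together with the silent action `τ`. -/
inductive Act (A : Type*) where
  | vis (α : Label A) : Act A
  | tau : Act A

/-- CCS terms (without recursion, restriction and relabelling) over action names `A` and
variables `V`. -/
inductive Term (A : Type*) (V : Type*) where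
  | nil : Term A V
  | var (x : V) : Term A V
  | pre (μ : Act A) (t : Term A V) : Term A V
  | plus (t u : Term A V) : Term A V
  | par (t u : Term A V) : Term A V

/-- Open terms: the set of variables is countably infinite. -/
abbrev OpenTerm (A : Type*) := Term A ℕ

/-- Processes, i.e. closed terms: terms in which no variable occurs. -/
abbrev Proc (A : Type*) := Term A Empty

/-- Application of a substitution to a term. A substitution is `σ : ℕ → OpenTerm A`, a closed
substitution is `σ : ℕ → Proc A`. -/
def Term.subst {A V W : Type*} (σ : V → Term A W) : Term A V → Term A W
  | .nil => .nil
  | .var x => σ x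
  | .pre μ t => .pre μ (t.subst σ)
  | .plus t u => .plus (t.subst σ) (u.subst σ)
  | .par t u => .par (t.subst σ) (u.subst σ)

/-- The labelled transitions between processes: those provable from the SOS rules. -/
inductive Step {A : Type*} : Proc A → Act A → Proc A → Prop where
  | pre (μ : Act A) (p : Proc A) : Step (.pre μ p) μ p
  | plusLeft {μ : Act A} {p p' : Proc A} (q : Proc A) :
      Step p μ p' → Step (.plus p q) μ p'
  | plusRight {μ : Act A} (p : Proc A) {q q' : Proc A} :
      Step q μ q' → Step (.plus p q) μ q'
  | parLeft {μ : Act A} {p p' : Proc A} (q : Proc A) :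
      Step p μ p' → Step (.par p q) μ (.par p' q)
  | parRight {μ : Act A} (p : Proc A) {q q' : Proc A} :
      Step q μ q' → Step (.par p q) μ (.par p q')
  | sync {α : Label A} {p p' q q' : Proc A} :
      Step p (.vis α) p' → Step q (.vis α.bar) q' → Step (.par p q) .tau (.par p' q')

/-- `p →ε q`: the reflexive and transitive closure of `→τ`. -/
def Silent {A : Type*} : Proc A → Proc A → Prop :=
  Relation.ReflTransGen fun p q => Step p .tau q

/-- `p →ε →μ →ε q`, for an arbitrary action `μ`. -/
def StrictWeakStep {A : Type*} (p : Proc A) (μ : Act A) (q : Proc A) : Prop :=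
  ∃ p₁ p₂, Silent p p₁ ∧ Step p₁ μ p₂ ∧ Silent p₂ q

/-- `p →ε →μ →ε q` if `μ ≠ τ`, and `p →ε q` if `μ = τ`. -/
def WeakStep {A : Type*} (p : Proc A) : Act A → Proc A → Prop
  | .vis α, q => StrictWeakStep p (.vis α) q
  | .tau, q => Silent p q

/-- Weak bisimulations. -/
def IsWeakBisimulation {A : Type*} (R : Proc A → Proc A → Prop) : Prop :=
  (∀ p q, R p q → R q p) ∧
    ∀ p q, R p q → ∀ μ p', Step p μ p' →
      (μ = .tau ∧ R p' q) ∨ ∃ q', WeakStep q μ q' ∧ R p' q'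

/-- Weak bisimilarity: the union of all weak bisimulations. -/
def WeakBisimilar {A : Type*} (p q : Proc A) : Prop :=
  ∃ R : Proc A → Proc A → Prop, IsWeakBisimulation R ∧ R p q

/-- Rooted weak bisimilarity: each initial step of either process, including a `τ`-step, is
matched by a weak step of the other that contains at least one transition, to weakly bisimilar
processes. -/
def RootedWeakBisimilar {A : Type*} (p q : Proc A) : Prop :=
  (∀ μ p', Step p μ p' → ∃ q', StrictWeakStep q μ q' ∧ WeakBisimilar p' q') ∧
    ∀ μ q', Step q μ q' → ∃ p', StrictWeakStep p μ p' ∧ WeakBisimilar q' p'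

/-- An equation `t ≈ u` between open terms, as the pair `(t, u)`. -/
abbrev Equation (A : Type*) := OpenTerm A × OpenTerm A

/-- An equation `t ≈ u` is sound modulo rooted weak bisimilarity if `σ(t)` and `σ(u)` are rooted
weakly bisimilar for all closed substitutions `σ`. -/
def SoundRWB {A : Type*} (e : Equation A) : Prop :=
  ∀ σ : ℕ → Proc A, RootedWeakBisimilar (e.1.subst σ) (e.2.subst σ)

/-- Equality of terms up to associativity and commutativity of `+`. -/
inductive ACEq {A : Type*} : OpenTerm A → OpenTerm A → Prop where
  | comm (t u : OpenTerm A) : ACEq (.plus t u) (.plus u t)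
  | assoc (t u v : OpenTerm A) : ACEq (.plus (.plus t u) v) (.plus t (.plus u v))
  | refl (t : OpenTerm A) : ACEq t t
  | symm {t u : OpenTerm A} : ACEq t u → ACEq u t
  | trans {t u v : OpenTerm A} : ACEq t u → ACEq u v → ACEq t v
  | pre (μ : Act A) {t u : OpenTerm A} : ACEq t u → ACEq (.pre μ t) (.pre μ u)
  | plus {t u t' u' : OpenTerm A} :
      ACEq t u → ACEq t' u' → ACEq (.plus t t') (.plus u u')
  | par {t u t' u' : OpenTerm A} :
      ACEq t u → ACEq t' u' → ACEq (.par t t') (.par u u')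

/-- `E ⊢ t ≈ u`: derivability from the axiom system `E` by the rules of equational logic. Terms
that are equal up to associativity and commutativity of `+` are identified, so the reflexivity
rule applies to any two such terms. -/
inductive Derivable {A : Type*} (E : Set (Equation A)) : OpenTerm A → OpenTerm A → Prop where
  | ax {t u : OpenTerm A} : (t, u) ∈ E → Derivable E t u
  | refl {t u : OpenTerm A} : ACEq t u → Derivable E t u
  | symm {t u : OpenTerm A} : Derivable E t u → Derivable E u t
  | trans {t u v : OpenTerm A} : Derivable E t u → Derivable E u v → Derivable E t v
  | subst {t u : OpenTerm A} (σ : ℕ → OpenTerm A) :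
      Derivable E t u → Derivable E (t.subst σ) (u.subst σ)
  | pre (μ : Act A) {t u : OpenTerm A} :
      Derivable E t u → Derivable E (.pre μ t) (.pre μ u)
  | plus {t u t' u' : OpenTerm A} :
      Derivable E t u → Derivable E t' u' → Derivable E (.plus t t') (.plus u u')
  | par {t u t' u' : OpenTerm A} :
      Derivable E t u → Derivable E t' u' → Derivable E (.par t t') (.par u u')

/-- The summation `t₁ + ⋯ + tₖ`; the empty sum is `0`. -/
def sumList {A : Type*} : List (OpenTerm A) → OpenTerm A
  | [] => .nil
  | [t] => t
  | t :: u :: ts => .plus t (sumList (u :: ts))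

/-- The summation of `f 1, …, f n`. -/
def sumTo {A : Type*} (n : ℕ) (f : ℕ → OpenTerm A) : OpenTerm A :=
  sumList ((List.range n).map fun i => f (i + 1))

/-- The variable `x`. -/
def vx {A : Type*} : OpenTerm A := .var 0

/-- The variable `y`. -/
def vy {A : Type*} : OpenTerm A := .var 1

/-- The variables `z₁, z₂, …`, pairwise distinct and distinct from `x` and `y`. -/
def vz {A : Type*} (i : ℕ) : OpenTerm A := .var (i + 1)

/-- Moller's equation `Mₙ`:
`(x + y) ∥ ∑ zᵢ + ∑ (x ∥ zᵢ + y ∥ zᵢ) ≈ x ∥ ∑ zᵢ + y ∥ ∑ zᵢ + ∑ ((x + y) ∥ zᵢ)`,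
where the sums range over `1 ≤ i ≤ n`. -/
def moller (A : Type*) (n : ℕ) : Equation A :=
  (.plus (.par (.plus vx vy) (sumTo n vz))
      (sumTo n fun i => .plus (.par vx (vz i)) (.par vy (vz i))),
    .plus (.plus (.par vx (sumTo n vz)) (.par vy (sumTo n vz)))
      (sumTo n fun i => .par (.plus vx vy) (vz i)))

end CCS

namespace CCS

/-! For n ≥ 2, the left-hand side of Mₙ has one parallel summand, `(x + y) ∥ ∑ zᵢ`, in which firing
`x` leaves the variable set `Z = {z₁, …, zₙ}` and firing `z₁` leaves `{x, y}`. No summand on the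
right does both. The proof shows that an equation with fewer than n variables cannot destroy such a
summand.

Both sides of Mₙ are action-free of depth at most two, and soundness controls such terms.
Substituting `0` shows that action-freeness is preserved (`SoundRWB.actionFree`), and substituting
`a.0` that depth is (`SoundRWB.depth_eq`). The substitution `probe` shows that, at depth at most
two, the set of pairs (fired variable, remaining variables) is preserved (`SoundRWB.firings_eq`).
All these processes use a single name, so no τ arises and weak steps are ordinary steps.

The heart is `HasMollerSummand.transfer`. Suppose the summand of `σ(t)` comes from a composition in
`t`. Its component with variable set `Z` comes from fewer than |Z| variables, so some variable `v`
there has at least two variables in `σ(v)`. In `t`, firing `v` leaves the other component `r`; hence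
`u` has a parallel summand with `v` on one side and exactly the variables of `r` on the other. In
its instance, firing `x` leaves at least two variables, and `XGuarded` forces these to be `Z`. The
property then passes through derivations as part of `Related`, since the guard depends on firings
only. -/

variable {A V W U : Type*}

/-! ### Action-free terms, depth and substitution -/

/-- No action prefix occurs in the term. -/
def ActionFree : Term A V → Prop
  | .nil => True
  | .var _ => True
  | .pre _ _ => False
  | .plus t u => ActionFree t ∧ ActionFree u
  | .par t u => ActionFree t ∧ ActionFree u

/-- Every prefix of the term is the name `a`. -/
def OnlyName (a : A) : Term A V → Prop
  | .nil => True
  | .var _ => True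
  | .pre μ t => μ = .vis (.name a) ∧ OnlyName a t
  | .plus t u => OnlyName a t ∧ OnlyName a u
  | .par t u => OnlyName a t ∧ OnlyName a u

/-- The depth of a term, where each variable counts as one action. -/
def depth : Term A V → ℕ
  | .nil => 0
  | .var _ => 1
  | .pre _ t => depth t + 1
  | .plus t u => max (depth t) (depth u)
  | .par t u => depth t + depth u

/-- The variables of a term. -/
def vars : OpenTerm A → Finset ℕ
  | .nil => ∅
  | .var v => {v}
  | .pre _ t => vars t
  | .plus t u => vars t ∪ vars u
  | .par t u => vars t ∪ vars u

/-- The pairs `(v, S)` such that `v` has an occurrence in the term whose parallel siblings have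
`S` as their set of variables. -/
def firings : OpenTerm A → Set (ℕ × Finset ℕ)
  | .nil => ∅
  | .var v => {(v, ∅)}
  | .pre _ _ => ∅
  | .plus t u => firings t ∪ firings u
  | .par t u => {e | (∃ S, (e.1, S) ∈ firings t ∧ e.2 = S ∪ vars u) ∨
      ∃ S, (e.1, S) ∈ firings u ∧ e.2 = vars t ∪ S}

/-- `p ∥ q` is a summand of the term up to parallel components without variables, and both `p`
and `q` contain variables. -/
inductive ParSummand (p q : OpenTerm A) : OpenTerm A → Prop where
  | self : (vars p).Nonempty → (vars q).Nonempty → ParSummand p q (.par p q)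
  | plusLeft {t : OpenTerm A} (u : OpenTerm A) : ParSummand p q t → ParSummand p q (.plus t u)
  | plusRight (t : OpenTerm A) {u : OpenTerm A} : ParSummand p q u → ParSummand p q (.plus t u)
  | parLeft {t u : OpenTerm A} : vars u = ∅ → ParSummand p q t → ParSummand p q (.par t u)
  | parRight {t u : OpenTerm A} : vars t = ∅ → ParSummand p q u → ParSummand p q (.par t u)

theorem subst_subst (σ : V → Term A W) (ρ : W → Term A U) (t : Term A V) :
    (t.subst σ).subst ρ = t.subst fun v => (σ v).subst ρ := by
  induction t <;> simp_all [Term.subst]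

theorem subst_var (t : Term A V) : t.subst .var = t := by
  induction t <;> simp_all [Term.subst]

theorem SoundRWB.subst {t u : OpenTerm A} (h : SoundRWB (t, u)) (σ : ℕ → OpenTerm A) :
    SoundRWB (t.subst σ, u.subst σ) := by
  intro ρ
  simpa only [subst_subst] using h fun v => (σ v).subst ρ

theorem RootedWeakBisimilar.symm {p q : Proc A} (h : RootedWeakBisimilar p q) :
    RootedWeakBisimilar q p := ⟨h.2, h.1⟩

theorem SoundRWB.symm {t u : OpenTerm A} (h : SoundRWB (t, u)) : SoundRWB (u, t) :=
  fun σ => (h σ).symm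

theorem WeakBisimilar.symm {p q : Proc A} (h : WeakBisimilar p q) : WeakBisimilar q p := by
  obtain ⟨R, hR, hpq⟩ := h
  exact ⟨R, hR, hR.1 _ _ hpq⟩

theorem vars_subst (σ : ℕ → OpenTerm A) {t : OpenTerm A} :
    vars (t.subst σ) = (vars t).biUnion fun v => vars (σ v) := by
  induction t <;> simp_all [Term.subst, vars, Finset.union_biUnion]

theorem ActionFree.of_subst {σ : V → Term A W} {t : Term A V} (h : ActionFree (t.subst σ)) :
    ActionFree t := by
  induction t <;> simp_all [Term.subst, ActionFree]

theorem ActionFree.subst_var {σ : ℕ → OpenTerm A} {t : OpenTerm A}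
    (h : ActionFree (t.subst σ)) : ∀ v ∈ vars t, ActionFree (σ v) := by
  induction t <;> simp_all [Term.subst, ActionFree, vars] <;> grind

theorem ActionFree.onlyName {a : A} {σ : V → Term A W} {t : Term A V} (h : ActionFree t)
    (hσ : ∀ v, OnlyName a (σ v)) : OnlyName a (t.subst σ) := by
  induction t <;> simp_all [Term.subst, ActionFree, OnlyName]

theorem depth_subst_of_one {σ : V → Term A W} (hσ : ∀ v, depth (σ v) = 1) (t : Term A V) :
    depth (t.subst σ) = depth t := by
  induction t <;> simp_all [Term.subst, depth]

theorem depth_subst_of_depth_eq_zero {σ : V → Term A W} {t : Term A V} (h : depth t = 0) :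
    depth (t.subst σ) = 0 := by
  induction t <;> simp_all [Term.subst, depth]

theorem depth_le_depth_subst {σ : ℕ → OpenTerm A} {t : OpenTerm A}
    (hσ : ∀ v ∈ vars t, 1 ≤ depth (σ v)) : depth t ≤ depth (t.subst σ) := by
  induction t with
  | nil => simp [depth]
  | var v => simpa [depth, Term.subst, vars] using hσ
  | pre μ t ih => simpa [depth, Term.subst] using ih hσ
  | plus t u iht ihu =>
    have h1 := iht fun v hv => hσ v (by simp [vars, hv])
    have h2 := ihu fun v hv => hσ v (by simp [vars, hv])
    simp only [depth, Term.subst]; omega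
  | par t u iht ihu =>
    have h1 := iht fun v hv => hσ v (by simp [vars, hv])
    have h2 := ihu fun v hv => hσ v (by simp [vars, hv])
    simp only [depth, Term.subst]; omega

theorem ActionFree.depth_eq_zero_iff {t : OpenTerm A} (h : ActionFree t) :
    depth t = 0 ↔ vars t = ∅ := by
  induction t <;> simp_all [depth, vars, ActionFree]

theorem ActionFree.one_le_depth {t : OpenTerm A} (h : ActionFree t) (hv : (vars t).Nonempty) :
    1 ≤ depth t := by
  by_contra hc
  exact hv.ne_empty (h.depth_eq_zero_iff.1 (by omega))

/-! ### Firings -/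

theorem mem_vars_of_mem_firings {t : OpenTerm A} {v : ℕ} {S : Finset ℕ}
    (h : (v, S) ∈ firings t) : v ∈ vars t := by
  induction t generalizing S <;> simp_all [firings, vars] <;> grind

theorem ActionFree.exists_mem_firings {t : OpenTerm A} (ht : ActionFree t) {v : ℕ}
    (h : v ∈ vars t) : ∃ S, (v, S) ∈ firings t := by
  induction t <;> simp_all [firings, vars, ActionFree] <;> grind

/-- A parallel composition of depth at most one has a component of depth zero, and an action-free
term of depth zero contains no variable. -/
theorem ActionFree.mem_firings_iff {t : OpenTerm A} (ht : ActionFree t) (hd : depth t ≤ 1)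
    {v : ℕ} {S : Finset ℕ} : (v, S) ∈ firings t ↔ v ∈ vars t ∧ S = ∅ := by
  suffices h : (v, S) ∈ firings t → S = ∅ by
    refine ⟨fun hv => ⟨mem_vars_of_mem_firings hv, h hv⟩, ?_⟩
    rintro ⟨hv, rfl⟩
    obtain ⟨S', hS'⟩ := ht.exists_mem_firings hv
    clear h
    induction t generalizing S' with
    | nil => simp [vars] at hv
    | var w => simpa [vars, firings] using hv
    | pre => exact ht.elim
    | plus t u iht ihu =>
      simp only [depth] at hd
      simp only [firings] at hS' ⊢
      rcases hS' with h | h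
      · exact .inl (iht ht.1 (by omega) (mem_vars_of_mem_firings h) S' h)
      · exact .inr (ihu ht.2 (by omega) (mem_vars_of_mem_firings h) S' h)
    | par t u iht ihu =>
      simp only [depth] at hd
      simp only [firings] at hS' ⊢
      rcases hS' with ⟨T, h, -⟩ | ⟨T, h, -⟩
      · have h1 := ht.1.one_le_depth ⟨v, mem_vars_of_mem_firings h⟩
        exact .inl ⟨∅, iht ht.1 (by omega) (mem_vars_of_mem_firings h) T h,
          by simp [ht.2.depth_eq_zero_iff.1 (by omega)]⟩
      · have h1 := ht.2.one_le_depth ⟨v, mem_vars_of_mem_firings h⟩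
        exact .inr ⟨∅, ihu ht.2 (by omega) (mem_vars_of_mem_firings h) T h,
          by simp [ht.1.depth_eq_zero_iff.1 (by omega)]⟩
  intro h
  induction t generalizing S with
  | nil => simp [firings] at h
  | var w => simp [firings] at h; exact h.2
  | pre => exact ht.elim
  | plus t u iht ihu =>
    simp only [depth] at hd
    rcases h with h | h
    · exact iht ht.1 (by omega) h
    · exact ihu ht.2 (by omega) h
  | par t u iht ihu =>
    simp only [depth] at hd
    rcases h with ⟨T, h, hS⟩ | ⟨T, h, hS⟩
    · have h1 := ht.1.one_le_depth ⟨v, mem_vars_of_mem_firings h⟩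
      simp only at hS h
      rw [hS, iht ht.1 (by omega) h, ht.2.depth_eq_zero_iff.1 (by omega)]; rfl
    · have h1 := ht.2.one_le_depth ⟨v, mem_vars_of_mem_firings h⟩
      simp only at hS h
      rw [hS, ihu ht.2 (by omega) h, ht.1.depth_eq_zero_iff.1 (by omega)]; rfl

theorem vars_eq_of_firings_eq {t u : OpenTerm A} (ht : ActionFree t) (hu : ActionFree u)
    (h : firings t = firings u) : vars t = vars u := by
  ext v
  constructor
  · intro hv
    obtain ⟨S, hS⟩ := ht.exists_mem_firings hv
    exact mem_vars_of_mem_firings (h ▸ hS)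
  · intro hv
    obtain ⟨S, hS⟩ := hu.exists_mem_firings hv
    exact mem_vars_of_mem_firings (h ▸ hS)

/-! ### Processes over a single name -/

/-- Without co-names the synchronisation rule never applies, so τ does not occur. Weak steps of such
processes are therefore ordinary steps. -/
theorem OnlyName.step {a : A} {p p' : Proc A} {μ : Act A} (h : Step p μ p')
    (hp : OnlyName a p) : μ = .vis (.name a) ∧ OnlyName a p' ∧ depth p' + 1 ≤ depth p := by
  induction h with
  | pre μ p => exact ⟨hp.1, hp.2, le_rfl⟩
  | plusLeft q _ ih =>
    obtain ⟨h1, h2, h3⟩ := ih hp.1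
    exact ⟨h1, h2, by simp only [depth]; omega⟩
  | plusRight p _ ih =>
    obtain ⟨h1, h2, h3⟩ := ih hp.2
    exact ⟨h1, h2, by simp only [depth]; omega⟩
  | parLeft q _ ih =>
    obtain ⟨h1, h2, h3⟩ := ih hp.1
    exact ⟨h1, ⟨h2, hp.2⟩, by simp only [depth]; omega⟩
  | parRight p _ ih =>
    obtain ⟨h1, h2, h3⟩ := ih hp.2
    exact ⟨h1, ⟨hp.1, h2⟩, by simp only [depth]; omega⟩
  | @sync α _ _ _ _ _ _ ih1 ih2 =>
    have h1 := (ih1 hp.1).1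
    have h2 := (ih2 hp.2).1
    rw [← h1] at h2
    exact absurd (Act.vis.inj h2) α.bar_ne

theorem OnlyName.exists_step {a : A} {p : Proc A} (hp : OnlyName a p) (h : depth p ≠ 0) :
    ∃ p', Step p (.vis (.name a)) p' ∧ depth p' + 1 = depth p := by
  induction p with
  | nil => simp [depth] at h
  | var v => exact v.elim
  | pre μ p _ =>
    obtain ⟨rfl, -⟩ := hp
    exact ⟨p, .pre _ _, rfl⟩
  | plus p q ihp ihq =>
    simp only [depth] at h ⊢
    rcases le_total (depth p) (depth q) with hle | hle
    · obtain ⟨q', hs, hd⟩ := ihq hp.2 (by omega)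
      exact ⟨q', .plusRight _ hs, by omega⟩
    · obtain ⟨p', hs, hd⟩ := ihp hp.1 (by omega)
      exact ⟨p', .plusLeft _ hs, by omega⟩
  | par p q ihp ihq =>
    simp only [depth] at h ⊢
    by_cases h0 : depth p = 0
    · obtain ⟨q', hs, hd⟩ := ihq hp.2 (by omega)
      exact ⟨_, .parRight _ hs, by simp only [depth]; omega⟩
    · obtain ⟨p', hs, hd⟩ := ihp hp.1 h0
      exact ⟨_, .parLeft _ hs, by simp only [depth]; omega⟩

theorem OnlyName.eq_of_silent {a : A} {p q : Proc A} (hp : OnlyName a p) (h : Silent p q) :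
    q = p := by
  rcases Relation.ReflTransGen.cases_head h with h | ⟨r, hr, -⟩
  · exact h.symm
  · exact absurd (hp.step hr).1 (by simp)

theorem OnlyName.step_of_strictWeakStep {a : A} {p q : Proc A} {μ : Act A} (hp : OnlyName a p)
    (h : StrictWeakStep p μ q) : Step p μ q := by
  obtain ⟨p₁, p₂, h1, h2, h3⟩ := h
  obtain rfl := hp.eq_of_silent h1
  obtain rfl := (hp.step h2).2.1.eq_of_silent h3
  exact h2

theorem WeakBisimilar.exists_step {a : A} {p q p' : Proc A} (h : WeakBisimilar p q)
    (hq : OnlyName a q) (hs : Step p (.vis (.name a)) p') :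
    ∃ q', Step q (.vis (.name a)) q' ∧ WeakBisimilar p' q' := by
  obtain ⟨R, hR, hpq⟩ := h
  rcases hR.2 p q hpq _ p' hs with ⟨h, -⟩ | ⟨q', hq', hr⟩
  · cases h
  · exact ⟨q', hq.step_of_strictWeakStep hq', R, hR, hr⟩

theorem RootedWeakBisimilar.exists_step {a : A} {p q p' : Proc A}
    (h : RootedWeakBisimilar p q) (hq : OnlyName a q) (hs : Step p (.vis (.name a)) p') :
    ∃ q', Step q (.vis (.name a)) q' ∧ WeakBisimilar p' q' := by
  obtain ⟨q', hq', hw⟩ := h.1 _ _ hs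
  exact ⟨q', hq.step_of_strictWeakStep hq', hw⟩

/-- A longest run of `p` is matched step by step by `q`. -/
theorem WeakBisimilar.depth_le {a : A} {p q : Proc A} (h : WeakBisimilar p q)
    (hp : OnlyName a p) (hq : OnlyName a q) : depth p ≤ depth q := by
  induction hn : depth p generalizing p q with
  | zero => exact Nat.zero_le _
  | succ n ih =>
    obtain ⟨p', hs, hd⟩ := hp.exists_step (by omega)
    obtain ⟨q', hs', hw⟩ := h.exists_step hq hs
    have := ih hw (hp.step hs).2.1 (hq.step hs').2.1 (by omega)
    have := (hq.step hs').2.2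
    omega

theorem WeakBisimilar.depth_eq {a : A} {p q : Proc A} (h : WeakBisimilar p q)
    (hp : OnlyName a p) (hq : OnlyName a q) : depth p = depth q :=
  le_antisymm (h.depth_le hp hq) (h.symm.depth_le hq hp)

theorem RootedWeakBisimilar.depth_le {a : A} {p q : Proc A} (h : RootedWeakBisimilar p q)
    (hp : OnlyName a p) (hq : OnlyName a q) : depth p ≤ depth q := by
  by_cases h0 : depth p = 0
  · omega
  obtain ⟨p', hs, hd⟩ := hp.exists_step h0
  obtain ⟨q', hs', hw⟩ := h.exists_step hq hs
  have := hw.depth_le (hp.step hs).2.1 (hq.step hs').2.1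
  have := (hq.step hs').2.2
  omega

theorem SoundRWB.depth_eq [Nonempty A] {t u : OpenTerm A} (h : SoundRWB (t, u))
    (ht : ActionFree t) (hu : ActionFree u) : depth t = depth u := by
  obtain ⟨a⟩ := ‹Nonempty A›
  let σ : ℕ → Proc A := fun _ => .pre (.vis (.name a)) .nil
  have hσ : ∀ v, OnlyName a (σ v) := fun _ => ⟨rfl, trivial⟩
  have h1 : ∀ t : OpenTerm A, depth (t.subst σ) = depth t := depth_subst_of_one fun _ => rfl
  rw [← h1 t, ← h1 u]
  exact le_antisymm ((h σ).depth_le (ht.onlyName hσ) (hu.onlyName hσ))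
    ((h σ).symm.depth_le (hu.onlyName hσ) (ht.onlyName hσ))

theorem ActionFree.not_step_zero {t : OpenTerm A} (ht : ActionFree t) {μ : Act A} {p : Proc A} :
    ¬ Step (t.subst fun _ => .nil) μ p := by
  induction t generalizing μ p with
  | nil => rintro ⟨⟩
  | var v => rintro ⟨⟩
  | pre => exact ht.elim
  | plus t u iht ihu =>
    intro h
    cases h with
    | plusLeft _ h => exact iht ht.1 h
    | plusRight _ h => exact ihu ht.2 h
  | par t u iht ihu =>
    intro h
    cases h with
    | parLeft _ h => exact iht ht.1 h
    | parRight _ h => exact ihu ht.2 h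
    | sync h _ => exact iht ht.1 h

theorem exists_step_zero {t : OpenTerm A} (ht : ¬ ActionFree t) :
    ∃ μ p, Step (t.subst fun _ => (.nil : Proc A)) μ p := by
  induction t with
  | nil => exact (ht trivial).elim
  | var v => exact (ht trivial).elim
  | pre μ t => exact ⟨_, _, .pre _ _⟩
  | plus t u iht ihu =>
    by_cases h : ActionFree t
    · obtain ⟨μ, p, hs⟩ := ihu fun hu => ht ⟨h, hu⟩
      exact ⟨μ, p, .plusRight _ hs⟩
    · obtain ⟨μ, p, hs⟩ := iht h
      exact ⟨μ, p, .plusLeft _ hs⟩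
  | par t u iht ihu =>
    by_cases h : ActionFree t
    · obtain ⟨μ, p, hs⟩ := ihu fun hu => ht ⟨h, hu⟩
      exact ⟨μ, _, .parRight _ hs⟩
    · obtain ⟨μ, p, hs⟩ := iht h
      exact ⟨μ, _, .parLeft _ hs⟩

/-- When every variable becomes `0`, the action-free terms are exactly those that turn inert.
Rootedness matters here: even a τ-step must be matched by at least one transition, so an inert
process cannot absorb it. -/
theorem SoundRWB.actionFree {t u : OpenTerm A} (h : SoundRWB (t, u)) (ht : ActionFree t) :
    ActionFree u := by
  by_contra hu
  obtain ⟨μ, p, hs⟩ := exists_step_zero hu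
  obtain ⟨q, ⟨p₁, p₂, h1, h2, -⟩, -⟩ := (h fun _ => .nil).2 _ _ hs
  rcases Relation.ReflTransGen.cases_head h1 with h1 | ⟨r, hr, -⟩
  · exact ht.not_step_zero (h1 ▸ h2)
  · exact ht.not_step_zero hr

/-! ### Soundness preserves the firings of terms of depth at most two -/

/-- The process `aᵏ`. -/
def power (a : A) : ℕ → Proc A
  | 0 => .nil
  | k + 1 => .pre (.vis (.name a)) (power a k)

/-- The closed substitution mapping `v` to `a` and `w ≠ v` to `a.(a + aʷ⁺³)`. -/
def probe (a : A) (v w : ℕ) : Proc A :=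
  .pre (.vis (.name a)) (if w = v then .nil else .plus (power a 1) (power a (w + 3)))

/-- The depth of the process reached by the first step of `probe a v w`. -/
def probeDepth (v w : ℕ) : ℕ := if w = v then 0 else w + 3

theorem onlyName_power (a : A) (k : ℕ) : OnlyName a (power a k) := by
  induction k with
  | zero => trivial
  | succ k ih => exact ⟨rfl, ih⟩

theorem depth_power (a : A) (k : ℕ) : depth (power a k) = k := by
  induction k with
  | zero => rfl
  | succ k ih => simp [power, depth, ih]

theorem onlyName_probe (a : A) (v w : ℕ) : OnlyName a (probe a v w) := by
  refine ⟨rfl, ?_⟩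
  split_ifs
  · trivial
  · exact ⟨onlyName_power _ _, onlyName_power _ _⟩

theorem probeDepth_injective (v : ℕ) : Function.Injective (probeDepth v) := by
  intro w w' h
  simp only [probeDepth] at h
  split_ifs at h <;> omega

theorem probe_step {a : A} {v w : ℕ} {p : Proc A} (h : Step (probe a v w) (.vis (.name a)) p) :
    depth p = probeDepth v w ∧
      (depth p = 0 ∨ ∃ p', Step p (.vis (.name a)) p' ∧ depth p' = 0) := by
  cases h
  unfold probeDepth
  split_ifs
  · simp [depth]
  · simp only [depth, depth_power]
    exact ⟨by omega, .inr ⟨.nil, .plusLeft _ (.pre _ _), rfl⟩⟩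

/-- `p` has a step to a process that is not inert and cannot become inert in one step. -/
def HasSlowStep (a : A) (p : Proc A) : Prop :=
  ∃ q, Step p (.vis (.name a)) q ∧ depth q ≠ 0 ∧
    ∀ q', Step q (.vis (.name a)) q' → depth q' ≠ 0

theorem HasSlowStep.parLeft {a : A} {p : Proc A} (h : HasSlowStep a p) (r : Proc A) :
    HasSlowStep a (.par p r) := by
  obtain ⟨q, hs, hd, hq⟩ := h
  refine ⟨_, .parLeft _ hs, by simp only [depth]; omega, fun q' hq' => ?_⟩
  cases hq' with
  | parLeft _ h => have := hq _ h; simp only [depth]; omega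
  | parRight _ h => simp only [depth]; omega

theorem HasSlowStep.parRight {a : A} {p : Proc A} (h : HasSlowStep a p) (r : Proc A) :
    HasSlowStep a (.par r p) := by
  obtain ⟨q, hs, hd, hq⟩ := h
  refine ⟨_, .parRight _ hs, by simp only [depth]; omega, fun q' hq' => ?_⟩
  cases hq' with
  | parLeft _ h => simp only [depth]; omega
  | parRight _ h => have := hq _ h; simp only [depth]; omega

/-- `probe` sends `v` to `a.0`, so firing an occurrence of `v` replaces it by `0`. The residual is
again an instance of an action-free term. -/
theorem exists_step_of_mem_firings (a : A) {v : ℕ} {S : Finset ℕ} {t : OpenTerm A}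
    (ht : ActionFree t) (h : (v, S) ∈ firings t) :
    ∃ c : OpenTerm A, ActionFree c ∧ vars c = S ∧ depth c + 1 ≤ depth t ∧
      Step (t.subst (probe a v)) (.vis (.name a)) (c.subst (probe a v)) := by
  induction t generalizing S with
  | nil => simp [firings] at h
  | var w =>
    simp only [firings, Set.mem_singleton_iff, Prod.mk.injEq] at h
    obtain ⟨rfl, rfl⟩ := h
    refine ⟨.nil, trivial, rfl, le_rfl, ?_⟩
    have : probe a v v = .pre (.vis (.name a)) .nil := by simp [probe]
    simp only [Term.subst, this]
    exact .pre _ _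
  | pre => exact ht.elim
  | plus t u iht ihu =>
    rcases h with h | h
    · obtain ⟨c, hc, hv, hd, hs⟩ := iht ht.1 h
      exact ⟨c, hc, hv, by simp only [depth]; omega, .plusLeft _ hs⟩
    · obtain ⟨c, hc, hv, hd, hs⟩ := ihu ht.2 h
      exact ⟨c, hc, hv, by simp only [depth]; omega, .plusRight _ hs⟩
  | par t u iht ihu =>
    rcases h with ⟨T, h, rfl⟩ | ⟨T, h, rfl⟩
    · obtain ⟨c, hc, hv, hd, hs⟩ := iht ht.1 h
      exact ⟨.par c u, ⟨hc, ht.2⟩, by simp [vars, hv], by simp only [depth]; omega,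
        .parLeft _ hs⟩
    · obtain ⟨c, hc, hv, hd, hs⟩ := ihu ht.2 h
      exact ⟨.par t c, ⟨ht.1, hc⟩, by simp [vars, hv], by simp only [depth]; omega,
        .parRight _ hs⟩

/-- If a variable `w ≠ v` fires instead of `v`, the residual has `a + a^(w+3)` as a parallel
component, whose long branch provides the slow step whatever runs beside it. -/
theorem mem_firings_or_hasSlowStep {a : A} {v : ℕ} {t : OpenTerm A} {q : Proc A}
    (ht : ActionFree t) (h : Step (t.subst (probe a v)) (.vis (.name a)) q) :
    (∃ c : OpenTerm A, ActionFree c ∧ depth c + 1 ≤ depth t ∧ q = c.subst (probe a v) ∧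
      (v, vars c) ∈ firings t) ∨ HasSlowStep a q := by
  induction t generalizing q with
  | nil => cases h
  | var w =>
    simp only [Term.subst, probe] at h
    cases h
    split_ifs with hw
    · exact .inl ⟨.nil, trivial, le_rfl, rfl, by simp [hw, firings, vars]⟩
    -- The long branch leads to `a^(w+2)` and then to `a^(w+1)`, which is not inert even for `w =
    -- 0`; this is what the offset 3 in `probe` secures.
    · refine .inr ⟨power a (w + 2), .plusRight _ (.pre _ _), by simp [depth_power], ?_⟩
      rintro q' hq'
      cases hq'
      simp [depth_power]
  | pre => exact ht.elim
  | plus t u iht ihu =>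
    cases h with
    | plusLeft _ h =>
      rcases iht ht.1 h with ⟨c, hc, hd, rfl, hf⟩ | h
      · exact .inl ⟨c, hc, by simp only [depth]; omega, rfl, .inl hf⟩
      · exact .inr h
    | plusRight _ h =>
      rcases ihu ht.2 h with ⟨c, hc, hd, rfl, hf⟩ | h
      · exact .inl ⟨c, hc, by simp only [depth]; omega, rfl, .inr hf⟩
      · exact .inr h
  | par t u iht ihu =>
    cases h with
    | parLeft _ h =>
      rcases iht ht.1 h with ⟨c, hc, hd, rfl, hf⟩ | h
      · exact .inl ⟨.par c u, ⟨hc, ht.2⟩, by simp only [depth]; omega, rfl,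
          .inl ⟨_, hf, rfl⟩⟩
      · exact .inr (h.parLeft _)
    | parRight _ h =>
      rcases ihu ht.2 h with ⟨c, hc, hd, rfl, hf⟩ | h
      · exact .inl ⟨.par t c, ⟨ht.1, hc⟩, by simp only [depth]; omega, rfl,
          .inr ⟨_, hf, rfl⟩⟩
      · exact .inr (h.parRight _)

/-- At depth at most one nothing of positive depth runs beside the fired variable. Its residual is
inert or can take the short branch `a`, which is why `probe` contains that branch. -/
theorem step_of_depth_le_one {a : A} {v : ℕ} {t : OpenTerm A} {q : Proc A} (ht : ActionFree t)
    (hd : depth t ≤ 1) (h : Step (t.subst (probe a v)) (.vis (.name a)) q) :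
    ∃ w ∈ vars t, depth q = probeDepth v w ∧
      (depth q = 0 ∨ ∃ q', Step q (.vis (.name a)) q' ∧ depth q' = 0) := by
  -- A component that moves has positive depth, so its parallel sibling has depth zero.
  have dead : ∀ {u : OpenTerm A}, ActionFree u → ∀ {q : Proc A},
      Step (u.subst (probe a v)) (.vis (.name a)) q → depth u ≠ 0 := by
    intro u hu q hs h0
    have := ((hu.onlyName (onlyName_probe a v)).step hs).2.2
    rw [depth_subst_of_depth_eq_zero h0] at this
    omega
  induction t generalizing q with
  | nil => cases h
  | var w => exact ⟨w, by simp [vars], probe_step h⟩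
  | pre => exact ht.elim
  | plus t u iht ihu =>
    simp only [depth] at hd
    cases h with
    | plusLeft _ h =>
      obtain ⟨w, hw, hq⟩ := iht ht.1 (by omega) h
      exact ⟨w, by simp [vars, hw], hq⟩
    | plusRight _ h =>
      obtain ⟨w, hw, hq⟩ := ihu ht.2 (by omega) h
      exact ⟨w, by simp [vars, hw], hq⟩
  | par t u iht ihu =>
    simp only [depth] at hd
    cases h with
    | parLeft _ h =>
      obtain ⟨w, hw, hq, hq'⟩ := iht ht.1 (by omega) h
      have h0 := dead ht.1 h
      have hu := depth_subst_of_depth_eq_zero (σ := probe a v) (t := u) (by omega)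
      refine ⟨w, by simp [vars, hw], by simpa [depth, hu] using hq, ?_⟩
      rcases hq' with hq' | ⟨q', hs, hq'⟩
      · exact .inl (by simpa [depth, hu] using hq')
      · exact .inr ⟨_, .parLeft _ hs, by simpa [depth, hu] using hq'⟩
    | parRight _ h =>
      obtain ⟨w, hw, hq, hq'⟩ := ihu ht.2 (by omega) h
      have h0 := dead ht.2 h
      have hu := depth_subst_of_depth_eq_zero (σ := probe a v) (t := t) (by omega)
      refine ⟨w, by simp [vars, hw], by simpa [depth, hu] using hq, ?_⟩
      rcases hq' with hq' | ⟨q', hs, hq'⟩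
      · exact .inl (by simpa [depth, hu] using hq')
      · exact .inr ⟨_, .parRight _ hs, by simpa [depth, hu] using hq'⟩

theorem exists_step_of_mem_vars {a : A} {v w : ℕ} {t : OpenTerm A} (ht : ActionFree t)
    (hd : depth t ≤ 1) (hw : w ∈ vars t) :
    ∃ q, Step (t.subst (probe a v)) (.vis (.name a)) q ∧ depth q = probeDepth v w := by
  induction t with
  | nil => simp [vars] at hw
  | var w' =>
    obtain rfl : w = w' := by simpa [vars] using hw
    exact ⟨_, .pre _ _, (probe_step (.pre _ _)).1⟩
  | pre => exact ht.elim
  | plus t u iht ihu =>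
    simp only [depth] at hd
    rcases Finset.mem_union.1 hw with hw | hw
    · obtain ⟨q, hs, hq⟩ := iht ht.1 (by omega) hw
      exact ⟨q, .plusLeft _ hs, hq⟩
    · obtain ⟨q, hs, hq⟩ := ihu ht.2 (by omega) hw
      exact ⟨q, .plusRight _ hs, hq⟩
  | par t u iht ihu =>
    simp only [depth] at hd
    rcases Finset.mem_union.1 hw with hw | hw
    · obtain ⟨q, hs, hq⟩ := iht ht.1 (by omega) hw
      have h1 := ht.1.one_le_depth ⟨w, hw⟩
      have hu := depth_subst_of_depth_eq_zero (σ := probe a v) (t := u) (by omega)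
      exact ⟨_, .parLeft _ hs, by simpa [depth, hu] using hq⟩
    · obtain ⟨q, hs, hq⟩ := ihu ht.2 (by omega) hw
      have h1 := ht.2.one_le_depth ⟨w, hw⟩
      have hu := depth_subst_of_depth_eq_zero (σ := probe a v) (t := t) (by omega)
      exact ⟨_, .parRight _ hs, by simpa [depth, hu] using hq⟩

/-- The variables can be read off from the depths reached in one step, because `probeDepth v` is
injective. -/
theorem vars_subset_of_weakBisimilar {a : A} {v : ℕ} {t u : OpenTerm A} (ht : ActionFree t)
    (hu : ActionFree u) (htd : depth t ≤ 1) (hud : depth u ≤ 1)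
    (h : WeakBisimilar (t.subst (probe a v)) (u.subst (probe a v))) : vars t ⊆ vars u := by
  intro w hw
  have hto := ht.onlyName (onlyName_probe a v)
  have huo := hu.onlyName (onlyName_probe a v)
  obtain ⟨q, hs, hq⟩ := exists_step_of_mem_vars (a := a) (v := v) ht htd hw
  obtain ⟨r, hr, hqr⟩ := h.exists_step huo hs
  obtain ⟨w', hw', hd, -⟩ := step_of_depth_le_one hu hud hr
  have := hqr.depth_eq (hto.step hs).2.1 (huo.step hr).2.1
  rwa [probeDepth_injective v (by omega : probeDepth v w = probeDepth v w')]

/-- Firing `v` in `t` leaves an instance of a term `c` of depth at most one, which has no slow step.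
Hence `u` must answer by firing `v` as well, and the two residuals then have the same variables. -/
theorem SoundRWB.firings_subset [Nonempty A] {t u : OpenTerm A} (h : SoundRWB (t, u))
    (ht : ActionFree t) (hd : depth t ≤ 2) : firings t ⊆ firings u := by
  have hu := h.actionFree ht
  have hd' := h.depth_eq ht hu
  obtain ⟨a⟩ := ‹Nonempty A›
  rintro ⟨v, S⟩ hS
  obtain ⟨c, hc, rfl, hcd, hs⟩ := exists_step_of_mem_firings a ht hS
  have huo := hu.onlyName (onlyName_probe a v)
  have hco := hc.onlyName (onlyName_probe a v)
  obtain ⟨q, hq, hw⟩ := (h (probe a v)).exists_step huo hs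
  have hqo := (huo.step hq).2.1
  rcases mem_firings_or_hasSlowStep hu hq with ⟨c', hc', hcd', rfl, hf⟩ | ⟨p, hp, hp0, hp'⟩
  · rwa [(vars_subset_of_weakBisimilar hc hc' (by omega) (by omega) hw).antisymm
      (vars_subset_of_weakBisimilar hc' hc (by omega) (by omega) hw.symm)]
  -- Here `u` answered by firing another variable. The slow step to `p` must be matched by some `r`
  -- that is inert or inert one step later, and `p` is neither.
  · obtain ⟨r, hr, hpr⟩ := hw.symm.exists_step hco hp
    have hro := (hco.step hr).2.1
    have hpo := (hqo.step hp).2.1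
    obtain ⟨-, -, -, hr0 | ⟨r', hr', hr0⟩⟩ := step_of_depth_le_one hc (by omega) hr
    · exact absurd (hpr.depth_eq hpo hro) (by omega)
    · obtain ⟨p', hpp, hw'⟩ := hpr.symm.exists_step hpo hr'
      have := hp' _ hpp
      exact absurd (hw'.depth_eq (hro.step hr').2.1 (hpo.step hpp).2.1) (by omega)

theorem SoundRWB.firings_eq [Nonempty A] {t u : OpenTerm A} (h : SoundRWB (t, u))
    (ht : ActionFree t) (hd : depth t ≤ 2) : firings t = firings u := by
  have hu := h.actionFree ht
  exact (h.firings_subset ht hd).antisymm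
    (h.symm.firings_subset hu ((h.depth_eq ht hu) ▸ hd))

/-! ### Parallel summands -/

theorem ParSummand.nonempty {p q t : OpenTerm A} (h : ParSummand p q t) :
    (vars p).Nonempty ∧ (vars q).Nonempty := by
  induction h <;> simp_all

theorem ParSummand.actionFree {p q t : OpenTerm A} (h : ParSummand p q t) (ht : ActionFree t) :
    ActionFree p ∧ ActionFree q := by
  induction h <;> simp_all [ActionFree]

theorem ParSummand.depth_le {p q t : OpenTerm A} (h : ParSummand p q t) :
    depth p + depth q ≤ depth t := by
  induction h <;> simp only [depth] at * <;> omega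

theorem ParSummand.vars_subset {p q t : OpenTerm A} (h : ParSummand p q t) :
    vars p ∪ vars q ⊆ vars t := by
  induction h <;> simp only [vars] at * <;> grind

theorem ParSummand.firings_subset {p q t : OpenTerm A} (h : ParSummand p q t) :
    firings (.par p q) ⊆ firings t := by
  induction h with
  | self => exact subset_rfl
  | plusLeft u _ ih => exact fun e he => .inl (ih he)
  | plusRight t _ ih => exact fun e he => .inr (ih he)
  | parLeft hu _ ih => exact fun e he => .inl ⟨e.2, ih he, by simp [hu]⟩
  | parRight ht _ ih => exact fun e he => .inr ⟨e.2, ih he, by simp [ht]⟩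

theorem ParSummand.depth_le_one {p q t : OpenTerm A} (h : ParSummand p q t) (ht : ActionFree t)
    (hd : depth t ≤ 2) : depth p ≤ 1 ∧ depth q ≤ 1 := by
  have h1 := (h.actionFree ht).1.one_le_depth h.nonempty.1
  have h2 := (h.actionFree ht).2.one_le_depth h.nonempty.2
  have h3 := h.depth_le
  omega

theorem ParSummand.mem_firings_iff {p q t : OpenTerm A} (h : ParSummand p q t)
    (ht : ActionFree t) (hd : depth t ≤ 2) {v : ℕ} {S : Finset ℕ} :
    (v, S) ∈ firings (.par p q) ↔ (v ∈ vars p ∧ S = vars q) ∨ (v ∈ vars q ∧ S = vars p) := by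
  obtain ⟨hp, hq⟩ := h.actionFree ht
  obtain ⟨hpd, hqd⟩ := h.depth_le_one ht hd
  simp [firings, hp.mem_firings_iff hpd, hq.mem_firings_iff hqd]

theorem vars_subst_nonempty {σ : ℕ → OpenTerm A} {t : OpenTerm A} (h : (vars t).Nonempty)
    (hσ : ∀ v ∈ vars t, (vars (σ v)).Nonempty) : (vars (t.subst σ)).Nonempty := by
  rw [vars_subst]
  exact h.biUnion hσ

theorem ParSummand.subst {σ : ℕ → OpenTerm A} {p q t : OpenTerm A} (h : ParSummand p q t)
    (hσ : ∀ v ∈ vars t, (vars (σ v)).Nonempty) :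
    ParSummand (p.subst σ) (q.subst σ) (t.subst σ) := by
  induction h with
  | self hp hq =>
    exact .self (vars_subst_nonempty hp fun v hv => hσ v (by simp [vars, hv]))
      (vars_subst_nonempty hq fun v hv => hσ v (by simp [vars, hv]))
  | plusLeft u _ ih => exact .plusLeft _ (ih fun v hv => hσ v (by simp [vars, hv]))
  | plusRight t _ ih => exact .plusRight _ (ih fun v hv => hσ v (by simp [vars, hv]))
  | parLeft hu _ ih =>
    exact .parLeft (by simp [vars_subst, hu]) (ih fun v hv => hσ v (by simp [vars, hv]))
  | parRight ht _ ih =>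
    exact .parRight (by simp [vars_subst, ht]) (ih fun v hv => hσ v (by simp [vars, hv]))

/-- A firing `(v, ∅)` means that `v` is itself a summand up to variable-free parallel components, so
the parallel summands of `σ v` survive in the instance. -/
theorem ParSummand.subst_of_var {σ : ℕ → OpenTerm A} {p q t : OpenTerm A} {v : ℕ}
    (hv : (v, ∅) ∈ firings t) (h : ParSummand p q (σ v)) : ParSummand p q (t.subst σ) := by
  induction t with
  | nil => simp [firings] at hv
  | var w =>
    obtain rfl : v = w := by simpa [firings] using hv
    exact h
  | pre => simp [firings] at hv
  | plus t u iht ihu =>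
    rcases hv with hv | hv
    · exact .plusLeft _ (iht hv)
    · exact .plusRight _ (ihu hv)
  | par t u iht ihu =>
    rcases hv with ⟨S, hv, hS⟩ | ⟨S, hv, hS⟩
    · obtain ⟨rfl, hu⟩ := Finset.union_eq_empty.1 hS.symm
      exact .parLeft (by simp [vars_subst, hu]) (iht hv)
    · obtain ⟨ht, rfl⟩ := Finset.union_eq_empty.1 hS.symm
      exact .parRight (by simp [vars_subst, ht]) (ihu hv)

/-- The condition on `σ` ensures that a variable-free component of the instance comes from a
variable-free component of `t`. -/
theorem parSummand_subst_cases {σ : ℕ → OpenTerm A} {p q t : OpenTerm A} (ht : ActionFree t)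
    (hσ : ∀ v ∈ vars t, (vars (σ v)).Nonempty) (h : ParSummand p q (t.subst σ)) :
    (∃ v, (v, ∅) ∈ firings t ∧ ParSummand p q (σ v)) ∨
      ∃ p' q', ParSummand p' q' t ∧ p = p'.subst σ ∧ q = q'.subst σ := by
  have null : ∀ {u : OpenTerm A}, (∀ v ∈ vars u, (vars (σ v)).Nonempty) →
      vars (u.subst σ) = ∅ → vars u = ∅ := by
    intro u hu h0
    by_contra hne
    exact (vars_subst_nonempty (Finset.nonempty_iff_ne_empty.2 hne) hu).ne_empty h0
  induction t with
  | nil => cases h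
  | var v => exact .inl ⟨v, rfl, h⟩
  | pre => exact ht.elim
  | plus t u iht ihu =>
    cases h with
    | plusLeft _ h =>
      rcases iht ht.1 (fun v hv => hσ v (by simp [vars, hv])) h with
        ⟨v, hv, h⟩ | ⟨p', q', h, hp, hq⟩
      · exact .inl ⟨v, .inl hv, h⟩
      · exact .inr ⟨p', q', .plusLeft _ h, hp, hq⟩
    | plusRight _ h =>
      rcases ihu ht.2 (fun v hv => hσ v (by simp [vars, hv])) h with
        ⟨v, hv, h⟩ | ⟨p', q', h, hp, hq⟩
      · exact .inl ⟨v, .inr hv, h⟩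
      · exact .inr ⟨p', q', .plusRight _ h, hp, hq⟩
  | par t u iht ihu =>
    have hσt : ∀ v ∈ vars t, (vars (σ v)).Nonempty := fun v hv => hσ v (by simp [vars, hv])
    have hσu : ∀ v ∈ vars u, (vars (σ v)).Nonempty := fun v hv => hσ v (by simp [vars, hv])
    cases h with
    | self hp hq =>
      rw [vars_subst] at hp hq
      refine .inr ⟨t, u, .self ?_ ?_, rfl, rfl⟩
      · exact (Finset.biUnion_nonempty.1 hp).imp fun _ h => h.1
      · exact (Finset.biUnion_nonempty.1 hq).imp fun _ h => h.1
    | parLeft hu h =>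
      have hu := null hσu hu
      rcases iht ht.1 hσt h with ⟨v, hv, h⟩ | ⟨p', q', h, hp, hq⟩
      · exact .inl ⟨v, .inl ⟨∅, hv, by simp [hu]⟩, h⟩
      · exact .inr ⟨p', q', .parLeft hu h, hp, hq⟩
    | parRight ht' h =>
      have ht' := null hσt ht'
      rcases ihu ht.2 hσu h with ⟨v, hv, h⟩ | ⟨p', q', h, hp, hq⟩
      · exact .inl ⟨v, .inr ⟨∅, hv, by simp [ht']⟩, h⟩
      · exact .inr ⟨p', q', .parRight ht' h, hp, hq⟩

/-- The summand is the outermost composition around the firing with variables on both sides. It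
exists because `S` is nonempty. -/
theorem exists_parSummand_of_mem_firings {t : OpenTerm A} {v : ℕ} {S : Finset ℕ}
    (ht : ActionFree t) (h : (v, S) ∈ firings t) (hS : S.Nonempty) :
    ∃ p q, ParSummand p q t ∧ (v, S) ∈ firings (.par p q) := by
  induction t with
  | nil => simp [firings] at h
  | var w => simp_all [firings]
  | pre => exact ht.elim
  | plus t u iht ihu =>
    rcases h with h | h
    · obtain ⟨p, q, hs, h⟩ := iht ht.1 h
      exact ⟨p, q, .plusLeft _ hs, h⟩
    · obtain ⟨p, q, hs, h⟩ := ihu ht.2 h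
      exact ⟨p, q, .plusRight _ hs, h⟩
  | par t u iht ihu =>
    by_cases h1 : vars t = ∅
    · obtain ⟨p, q, hs, h⟩ := ihu ht.2 (by
        rcases h with ⟨T, h, -⟩ | ⟨T, h, h2⟩
        · simpa [h1] using mem_vars_of_mem_firings h
        · obtain rfl : S = T := by simpa [h1] using h2
          exact h)
      exact ⟨p, q, .parRight h1 hs, h⟩
    by_cases h2 : vars u = ∅
    · obtain ⟨p, q, hs, h⟩ := iht ht.1 (by
        rcases h with ⟨T, h, h3⟩ | ⟨T, h, -⟩
        · obtain rfl : S = T := by simpa [h2] using h3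
          exact h
        · simpa [h2] using mem_vars_of_mem_firings h)
      exact ⟨p, q, .parLeft h2 hs, h⟩
    exact ⟨t, u, .self (Finset.nonempty_iff_ne_empty.2 h1) (Finset.nonempty_iff_ne_empty.2 h2), h⟩

/-! ### The invariant -/

/-- Some parallel summand has the firings `(x, Z)` and `(z₁, {x, y})`. -/
def HasMollerSummand (Z : Finset ℕ) (t : OpenTerm A) : Prop :=
  ∃ p q, ParSummand p q t ∧ (0, Z) ∈ firings (.par p q) ∧ (2, {0, 1}) ∈ firings (.par p q)

/-- Whenever `x` fires, the remaining set of variables is `Z` or has at most one element. -/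
def XGuarded (Z : Finset ℕ) (t : OpenTerm A) : Prop :=
  ∀ S, (0, S) ∈ firings t → S = Z ∨ S.card ≤ 1

/-- The central counting argument. A summand inside some `σ v` is carried over by the firing `(v,
∅)`; otherwise a variable standing for several elements of `Z` pins down a matching summand of `u`.
-/
theorem HasMollerSummand.transfer [Nonempty A] {Z : Finset ℕ} {t u : OpenTerm A}
    {σ : ℕ → OpenTerm A} (h0 : 0 ∉ Z) (h2 : 2 ∈ Z) (hcard : (vars t).card < Z.card)
    (h : SoundRWB (t, u)) (ht : ActionFree (t.subst σ)) (hd : depth (t.subst σ) ≤ 2)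
    (hg : XGuarded Z (t.subst σ)) (hσ : ∀ v ∈ vars t, (vars (σ v)).Nonempty)
    (hm : HasMollerSummand Z (t.subst σ)) : HasMollerSummand Z (u.subst σ) := by
  have htf := ht.of_subst
  have huf := h.actionFree htf
  have htd : depth t ≤ 2 := (depth_le_depth_subst fun v hv =>
    (ht.subst_var v hv).one_le_depth (hσ v hv)).trans hd
  have hud : depth u ≤ 2 := (h.depth_eq htf huf) ▸ htd
  have hf := h.firings_eq htf htd
  have hσu : ∀ v ∈ vars u, (vars (σ v)).Nonempty := by
    rwa [← vars_eq_of_firings_eq htf huf hf]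
  have hus := (h.subst σ).actionFree ht
  have husd : depth (u.subst σ) ≤ 2 := ((h.subst σ).depth_eq ht hus) ▸ hd
  have hfs := (h.subst σ).firings_eq ht hd
  obtain ⟨p, q, hpq, hx, hz⟩ := hm
  rcases parSummand_subst_cases htf hσ hpq with ⟨v, hv, hp⟩ | ⟨p, q, hp, rfl, rfl⟩
  · exact ⟨p, q, .subst_of_var (hf ▸ hv) hp, hx, hz⟩
  rw [hpq.mem_firings_iff ht hd] at hx hz
  -- One component has variables `{0, 1}` and the other `Z`. They are different components because
  -- `0 ∉ Z`.
  obtain ⟨r, s, hr, hs, hrs, hst⟩ : ∃ r s, vars (Term.subst σ r) = {0, 1} ∧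
      vars (Term.subst σ s) = Z ∧ (vars r).Nonempty ∧ vars s ⊆ vars t ∧
      ∀ v ∈ vars s, (v, vars r) ∈ firings t := by
    have hsub := hp.firings_subset
    have hvs := hp.vars_subset
    rcases hx with ⟨hx, hZ⟩ | ⟨hx, hZ⟩
    · rcases hz with ⟨-, hz⟩ | ⟨-, hz⟩
      · exact absurd (hZ.trans hz.symm ▸ (by simp : (0 : ℕ) ∈ ({0, 1} : Finset ℕ))) h0
      · exact ⟨p, q, hz.symm, hZ.symm, hp.nonempty.1, Finset.union_subset_right hvs,
          fun v hv => hsub ((hp.mem_firings_iff htf htd).2 (.inr ⟨hv, rfl⟩))⟩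
    · rcases hz with ⟨-, hz⟩ | ⟨-, hz⟩
      · exact ⟨q, p, hz.symm, hZ.symm, hp.nonempty.2, Finset.union_subset_left hvs,
          fun v hv => hsub ((hp.mem_firings_iff htf htd).2 (.inl ⟨hv, rfl⟩))⟩
      · exact absurd (hZ.trans hz.symm ▸ (by simp : (0 : ℕ) ∈ ({0, 1} : Finset ℕ))) h0
  -- Pigeonhole: if every image had at most one variable, `Z` would have no more elements than `t`
  -- has variables.
  obtain ⟨v, hv, hv2⟩ : ∃ v ∈ vars s, 2 ≤ (vars (σ v)).card := by
    by_contra! hc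
    have h1 := Finset.card_biUnion_le_card_mul (vars s) (fun v => vars (σ v)) 1
      fun v hv => by have := hc v hv; omega
    rw [← vars_subst, hs] at h1
    have := Finset.card_le_card hst.1
    omega
  have key : ∀ p' q' : OpenTerm A, v ∈ vars p' → vars r = vars q' →
      (∀ w S, (w ∈ vars (p'.subst σ) ∧ S = vars (q'.subst σ)) ∨
        (w ∈ vars (q'.subst σ) ∧ S = vars (p'.subst σ)) → (w, S) ∈ firings (u.subst σ)) →
      vars (p'.subst σ) = Z ∧ vars (q'.subst σ) = {0, 1} := by
    intro p' q' hvp hrq hsub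
    have hq' : vars (q'.subst σ) = {0, 1} := by rw [← hr, vars_subst, vars_subst, hrq]
    refine ⟨?_, hq'⟩
    have hmem := hsub 0 (vars (p'.subst σ)) (.inr ⟨by simp [hq'], rfl⟩)
    rw [← hfs] at hmem
    -- Firing `0` leaves a set that contains the variables of `σ v`, at least two of them, so the
    -- guard leaves only `Z`.
    refine (hg _ hmem).resolve_right fun hc => ?_
    have : vars (σ v) ⊆ vars (p'.subst σ) := by
      rw [vars_subst]
      exact Finset.subset_biUnion_of_mem (fun v => vars (σ v)) hvp
    have := Finset.card_le_card this
    omega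
  obtain ⟨p', q', hpq', hvf⟩ := exists_parSummand_of_mem_firings huf (hf ▸ hst.2 v hv) hrs
  have hsum := hpq'.subst hσu
  have hiff := fun {w S} => hsum.mem_firings_iff hus husd (v := w) (S := S)
  refine ⟨_, _, hsum, ?_⟩
  rw [hiff, hiff]
  rcases (hpq'.mem_firings_iff huf hud).1 hvf with ⟨hvp, hrq⟩ | ⟨hvq, hrp⟩
  · obtain ⟨e1, e2⟩ := key p' q' hvp hrq fun w S hw => hsum.firings_subset (hiff.2 hw)
    simp [e1, e2, h2]
  · obtain ⟨e1, e2⟩ := key q' p' hvq hrp fun w S hw => hsum.firings_subset (hiff.2 hw.symm)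
    simp [e1, e2, h2]

theorem hasMollerSummand_plus {Z : Finset ℕ} {t u : OpenTerm A} :
    HasMollerSummand Z (.plus t u) ↔ HasMollerSummand Z t ∨ HasMollerSummand Z u := by
  constructor
  · rintro ⟨p, q, h, hpq⟩
    cases h with
    | plusLeft _ h => exact .inl ⟨p, q, h, hpq⟩
    | plusRight _ h => exact .inr ⟨p, q, h, hpq⟩
  · rintro (⟨p, q, h, hpq⟩ | ⟨p, q, h, hpq⟩)
    · exact ⟨p, q, .plusLeft _ h, hpq⟩
    · exact ⟨p, q, .plusRight _ h, hpq⟩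

/-- When both components contain variables, only the firings of the whole composition matter. This
makes the property compatible with `∥`. -/
theorem hasMollerSummand_par {Z : Finset ℕ} {t u : OpenTerm A} :
    HasMollerSummand Z (.par t u) ↔ (vars u = ∅ ∧ HasMollerSummand Z t) ∨
      (vars t = ∅ ∧ HasMollerSummand Z u) ∨ (vars t ≠ ∅ ∧ vars u ≠ ∅ ∧
        (0, Z) ∈ firings (.par t u) ∧ (2, {0, 1}) ∈ firings (.par t u)) := by
  constructor
  · rintro ⟨p, q, h, hpq⟩
    cases h with
    | self h1 h2 => exact .inr (.inr ⟨h1.ne_empty, h2.ne_empty, hpq⟩)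
    | parLeft hu h => exact .inl ⟨hu, p, q, h, hpq⟩
    | parRight ht h => exact .inr (.inl ⟨ht, p, q, h, hpq⟩)
  · rintro (⟨hu, p, q, h, hpq⟩ | ⟨ht, p, q, h, hpq⟩ | ⟨ht, hu, hpq⟩)
    · exact ⟨p, q, .parLeft hu h, hpq⟩
    · exact ⟨p, q, .parRight ht h, hpq⟩
    · exact ⟨t, u, .self (Finset.nonempty_iff_ne_empty.2 ht) (Finset.nonempty_iff_ne_empty.2 hu),
        hpq⟩

theorem not_hasMollerSummand_of_vars_eq_empty {Z : Finset ℕ} {t : OpenTerm A}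
    (h : vars t = ∅) : ¬ HasMollerSummand Z t := by
  rintro ⟨p, q, hpq, -⟩
  obtain ⟨v, hv⟩ := hpq.nonempty.1
  simpa [h] using hpq.vars_subset (Finset.mem_union_left _ hv)

/-- The two terms agree on all the notions that enter the invariant. -/
structure Alike (Z : Finset ℕ) (t u : OpenTerm A) : Prop where
  actionFree : ActionFree t ↔ ActionFree u
  vars_eq : vars t = vars u
  depth_eq : depth t = depth u
  firings_eq : firings t = firings u
  hasMollerSummand : HasMollerSummand Z t ↔ HasMollerSummand Z u

theorem Alike.refl (Z : Finset ℕ) (t : OpenTerm A) : Alike Z t t :=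
  ⟨.rfl, rfl, rfl, rfl, .rfl⟩

theorem Alike.symm {Z : Finset ℕ} {t u : OpenTerm A} (h : Alike Z t u) : Alike Z u t :=
  ⟨h.1.symm, h.2.symm, h.3.symm, h.4.symm, h.5.symm⟩

theorem Alike.trans {Z : Finset ℕ} {t u v : OpenTerm A} (h : Alike Z t u) (h' : Alike Z u v) :
    Alike Z t v :=
  ⟨h.1.trans h'.1, h.2.trans h'.2, h.3.trans h'.3, h.4.trans h'.4, h.5.trans h'.5⟩

theorem Alike.pre {Z : Finset ℕ} {t u : OpenTerm A} (h : Alike Z t u) (μ : Act A) :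
    Alike Z (.pre μ t) (.pre μ u) :=
  ⟨.rfl, h.2, by simp only [depth, h.3], rfl,
    iff_of_false (by rintro ⟨p, q, ⟨⟩, -⟩) (by rintro ⟨p, q, ⟨⟩, -⟩)⟩

theorem Alike.plus {Z : Finset ℕ} {t u t' u' : OpenTerm A} (h : Alike Z t u)
    (h' : Alike Z t' u') : Alike Z (.plus t t') (.plus u u') :=
  ⟨and_congr h.1 h'.1, by simp only [vars, h.2, h'.2], by simp only [depth, h.3, h'.3],
    by simp only [firings, h.4, h'.4], by simp only [hasMollerSummand_plus, h.5, h'.5]⟩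

theorem Alike.par {Z : Finset ℕ} {t u t' u' : OpenTerm A} (h : Alike Z t u)
    (h' : Alike Z t' u') : Alike Z (.par t t') (.par u u') := by
  have hf : firings (.par t t') = firings (.par u u') := by
    simp only [firings, h.4, h'.4, h.2, h'.2]
  exact ⟨and_congr h.1 h'.1, by simp only [vars, h.2, h'.2], by simp only [depth, h.3, h'.3],
    hf, by simp only [hasMollerSummand_par, h.5, h'.5, h.2, h'.2, hf]⟩

theorem Alike.subst {Z : Finset ℕ} {t : OpenTerm A} {σ ρ : ℕ → OpenTerm A}
    (h : ∀ v ∈ vars t, Alike Z (σ v) (ρ v)) : Alike Z (t.subst σ) (t.subst ρ) := by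
  induction t with
  | nil => exact .refl _ _
  | var v => exact h v (by simp [vars])
  | pre μ t ih => exact (ih h).pre μ
  | plus t u iht ihu =>
    exact (iht fun v hv => h v (by simp [vars, hv])).plus
      (ihu fun v hv => h v (by simp [vars, hv]))
  | par t u iht ihu =>
    exact (iht fun v hv => h v (by simp [vars, hv])).par
      (ihu fun v hv => h v (by simp [vars, hv]))

theorem ACEq.alike (Z : Finset ℕ) {t u : OpenTerm A} (h : ACEq t u) : Alike Z t u := by
  induction h with
  | comm t u =>
    exact ⟨and_comm, Finset.union_comm _ _, max_comm _ _, Set.union_comm _ _,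
      by simp only [hasMollerSummand_plus, or_comm]⟩
  | assoc t u v =>
    exact ⟨and_assoc, Finset.union_assoc _ _ _, max_assoc _ _ _, Set.union_assoc _ _ _,
      by simp only [hasMollerSummand_plus, or_assoc]⟩
  | refl t => exact .refl _ _
  | symm _ ih => exact ih.symm
  | trans _ _ ih ih' => exact ih.trans ih'
  | pre μ _ ih => exact ih.pre μ
  | plus _ _ ih ih' => exact ih.plus ih'
  | par _ _ ih ih' => exact ih.par ih'

theorem ACEq.subst {t u : OpenTerm A} (h : ACEq t u) (σ : ℕ → OpenTerm A) :
    ACEq (t.subst σ) (u.subst σ) := by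
  induction h with
  | comm t u => exact .comm _ _
  | assoc t u v => exact .assoc _ _ _
  | refl t => exact .refl _
  | symm _ ih => exact ih.symm
  | trans _ _ ih ih' => exact ih.trans ih'
  | pre μ _ ih => exact ih.pre μ
  | plus _ _ ih ih' => exact ih.plus ih'
  | par _ _ ih ih' => exact ih.par ih'

/-- Variables with variable-free images are first replaced by `0`. This changes nothing relevant in
the instances, adds no variables to the equation, and yields the condition on `σ` that
`HasMollerSummand.transfer` needs. -/
theorem HasMollerSummand.of_sound [Nonempty A] {Z : Finset ℕ} {t u : OpenTerm A}
    (h0 : 0 ∉ Z) (h2 : 2 ∈ Z) (hcard : (vars t).card < Z.card)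
    (h : SoundRWB (t, u)) (σ : ℕ → OpenTerm A) (ht : ActionFree (t.subst σ))
    (hd : depth (t.subst σ) ≤ 2) (hg : XGuarded Z (t.subst σ))
    (hm : HasMollerSummand Z (t.subst σ)) : HasMollerSummand Z (u.subst σ) := by
  classical
  have hu := (h.subst σ).actionFree ht
  let ν : ℕ → OpenTerm A := fun v => if vars (σ v) = ∅ then .nil else .var v
  have hν : ∀ {t : OpenTerm A}, ActionFree (t.subst σ) →
      Alike Z (t.subst σ) ((t.subst ν).subst σ) := by
    intro t ht
    rw [subst_subst]
    refine Alike.subst fun v hv => ?_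
    by_cases hv0 : vars (σ v) = ∅
    · have haf := ht.subst_var v hv
      simp only [ν, hv0, if_true, Term.subst]
      refine ⟨iff_of_true haf trivial, hv0, haf.depth_eq_zero_iff.2 hv0, ?_,
        iff_of_false (not_hasMollerSummand_of_vars_eq_empty hv0)
          (not_hasMollerSummand_of_vars_eq_empty rfl)⟩
      refine Set.eq_empty_of_forall_notMem fun e he => ?_
      simpa [hv0] using mem_vars_of_mem_firings (v := e.1) (S := e.2) he
    · simp only [ν, hv0, if_false, Term.subst]
      exact .refl _ _
  have hνv : ∀ v, vars (ν v) ⊆ {v} := by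
    intro v
    simp only [ν]
    split_ifs <;> simp [vars]
  have htν := hν ht
  rw [(hν hu).hasMollerSummand]
  refine HasMollerSummand.transfer h0 h2 ?_ (h.subst ν) (htν.1.1 ht) (htν.3 ▸ hd) ?_ ?_
    (htν.5.1 hm)
  · refine (Finset.card_le_card ?_).trans_lt hcard
    rw [vars_subst]
    intro w hw
    obtain ⟨v, hv, hwv⟩ := Finset.mem_biUnion.1 hw
    obtain rfl := Finset.mem_singleton.1 (hνv v hwv)
    exact hv
  · intro S hS
    exact hg S (htν.4 ▸ hS)
  · intro w hw
    rw [vars_subst] at hw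
    obtain ⟨v, -, hwv⟩ := Finset.mem_biUnion.1 hw
    obtain rfl := Finset.mem_singleton.1 (hνv v hwv)
    by_contra hne
    simp [ν, Finset.not_nonempty_iff_eq_empty.1 hne, vars] at hwv

/-- The relation between terms that is preserved by all derivations from a sound axiom system
whose equations have fewer variables than `Z` has elements. -/
structure Related (Z : Finset ℕ) (t u : OpenTerm A) : Prop where
  actionFree : ActionFree t ↔ ActionFree u
  depth_eq : ActionFree t → depth t = depth u
  firings_eq : ActionFree t → depth t ≤ 2 → firings t = firings u
  hasMollerSummand : ActionFree t → depth t ≤ 2 → XGuarded Z t →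
    (HasMollerSummand Z t ↔ HasMollerSummand Z u)

theorem Alike.related {Z : Finset ℕ} {t u : OpenTerm A} (h : Alike Z t u) : Related Z t u :=
  ⟨h.1, fun _ => h.3, fun _ _ => h.4, fun _ _ _ => h.5⟩

theorem XGuarded.congr {Z : Finset ℕ} {t u : OpenTerm A} (h : XGuarded Z t)
    (hf : firings t = firings u) : XGuarded Z u := fun S hS => h S (hf ▸ hS)

theorem Related.symm {Z : Finset ℕ} {t u : OpenTerm A} (h : Related Z t u) : Related Z u t where
  actionFree := h.1.symm
  depth_eq hu := (h.2 (h.1.2 hu)).symm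
  firings_eq hu hd := (h.3 (h.1.2 hu) (h.2 (h.1.2 hu) ▸ hd)).symm
  hasMollerSummand hu hd hg :=
    have ht := h.1.2 hu
    have htd : depth t ≤ 2 := h.2 ht ▸ hd
    (h.4 ht htd (hg.congr (h.3 ht htd).symm)).symm

theorem Related.trans {Z : Finset ℕ} {t u v : OpenTerm A} (h : Related Z t u)
    (h' : Related Z u v) : Related Z t v where
  actionFree := h.1.trans h'.1
  depth_eq ht := (h.2 ht).trans (h'.2 (h.1.1 ht))
  firings_eq ht hd := (h.3 ht hd).trans (h'.3 (h.1.1 ht) (h.2 ht ▸ hd))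
  hasMollerSummand ht hd hg :=
    (h.4 ht hd hg).trans (h'.4 (h.1.1 ht) (h.2 ht ▸ hd) (hg.congr (h.3 ht hd)))

theorem Related.vars_eq {Z : Finset ℕ} {t u : OpenTerm A} (h : Related Z t u)
    (ht : ActionFree t) (hd : depth t ≤ 2) : vars t = vars u :=
  vars_eq_of_firings_eq ht (h.1.1 ht) (h.3 ht hd)

theorem Related.pre {Z : Finset ℕ} (t u : OpenTerm A) (μ : Act A) :
    Related Z (.pre μ t) (.pre μ u) :=
  ⟨.rfl, fun h => h.elim, fun h => h.elim, fun h => h.elim⟩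

theorem Related.plus {Z : Finset ℕ} {t u t' u' : OpenTerm A} (h : Related Z t u)
    (h' : Related Z t' u') : Related Z (.plus t t') (.plus u u') where
  actionFree := and_congr h.1 h'.1
  depth_eq ht := by simp only [depth, h.2 ht.1, h'.2 ht.2]
  firings_eq ht hd := by
    simp only [depth] at hd
    simp only [firings, h.3 ht.1 (by omega), h'.3 ht.2 (by omega)]
  hasMollerSummand ht hd hg := by
    simp only [depth] at hd
    rw [hasMollerSummand_plus, hasMollerSummand_plus,
      h.4 ht.1 (by omega) fun S hS => hg S (.inl hS),
      h'.4 ht.2 (by omega) fun S hS => hg S (.inr hS)]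

theorem Related.par {Z : Finset ℕ} {t u t' u' : OpenTerm A} (h : Related Z t u)
    (h' : Related Z t' u') : Related Z (.par t t') (.par u u') where
  actionFree := and_congr h.1 h'.1
  depth_eq ht := by simp only [depth, h.2 ht.1, h'.2 ht.2]
  firings_eq ht hd := by
    simp only [depth] at hd
    simp only [firings, h.3 ht.1 (by omega), h'.3 ht.2 (by omega),
      h.vars_eq ht.1 (by omega), h'.vars_eq ht.2 (by omega)]
  hasMollerSummand ht hd hg := by
    simp only [depth] at hd
    have hf : firings (.par t t') = firings (.par u u') := by
      simp only [firings, h.3 ht.1 (by omega), h'.3 ht.2 (by omega),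
        h.vars_eq ht.1 (by omega), h'.vars_eq ht.2 (by omega)]
    rw [hasMollerSummand_par, hasMollerSummand_par, hf, h.vars_eq ht.1 (by omega),
      h'.vars_eq ht.2 (by omega)]
    refine or_congr (and_congr_right fun hu' => ?_) (or_congr (and_congr_right fun hu => ?_) .rfl)
    -- With a variable-free sibling the firings of the component are firings of the composition, so
    -- the guard is inherited.
    · refine h.4 ht.1 (by omega) fun S hS => hg S (.inl ⟨S, hS, ?_⟩)
      rw [h'.vars_eq ht.2 (by omega), hu', Finset.union_empty]
    · refine h'.4 ht.2 (by omega) fun S hS => hg S (.inr ⟨S, hS, ?_⟩)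
      rw [h.vars_eq ht.1 (by omega), hu, Finset.empty_union]

/-- Quantifying over all `σ` absorbs the substitution rule, so soundness is only needed for the
axioms. -/
theorem Derivable.related [Nonempty A] {E : Set (Equation A)} {Z : Finset ℕ}
    (hsound : ∀ e ∈ E, SoundRWB e) (h0 : 0 ∉ Z) (h2 : 2 ∈ Z)
    (hcard : ∀ e ∈ E, (vars e.1).card < Z.card ∧ (vars e.2).card < Z.card)
    {t u : OpenTerm A} (h : Derivable E t u) (σ : ℕ → OpenTerm A) :
    Related Z (t.subst σ) (u.subst σ) := by
  induction h generalizing σ with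
  | @ax t u he =>
    have hs := hsound _ he
    have hσ := hs.subst σ
    have haf : ActionFree (t.subst σ) ↔ ActionFree (u.subst σ) :=
      ⟨hσ.actionFree, hσ.symm.actionFree⟩
    refine ⟨haf, fun ht => hσ.depth_eq ht (haf.1 ht), hσ.firings_eq, fun ht hd hg => ⟨?_, ?_⟩⟩
    · exact HasMollerSummand.of_sound h0 h2 (hcard _ he).1 hs σ ht hd hg
    · exact HasMollerSummand.of_sound h0 h2 (hcard _ he).2 hs.symm σ (haf.1 ht)
        (hσ.depth_eq ht (haf.1 ht) ▸ hd) (hg.congr (hσ.firings_eq ht hd))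
  | refl h => exact ((h.subst σ).alike Z).related
  | symm _ ih => exact (ih σ).symm
  | trans _ _ ih ih' => exact (ih σ).trans (ih' σ)
  | subst ρ _ ih =>
    rw [subst_subst, subst_subst]
    exact ih _
  | pre μ _ _ => exact .pre _ _ μ
  | plus _ _ ih ih' => exact (ih σ).plus (ih' σ)
  | par _ _ ih ih' => exact (ih σ).par (ih' σ)

/-! ### Moller's equations -/

theorem actionFree_sumList {L : List (OpenTerm A)} (h : ∀ t ∈ L, ActionFree t) :
    ActionFree (sumList L) := by
  induction L using sumList.induct <;> simp_all [sumList, ActionFree]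

theorem depth_sumList_le {L : List (OpenTerm A)} {k : ℕ} (h : ∀ t ∈ L, depth t ≤ k) :
    depth (sumList L) ≤ k := by
  induction L using sumList.induct <;> simp_all [sumList, depth]

theorem mem_vars_sumList {L : List (OpenTerm A)} {v : ℕ} :
    v ∈ vars (sumList L) ↔ ∃ t ∈ L, v ∈ vars t := by
  induction L using sumList.induct <;> simp_all [sumList, vars]

theorem mem_firings_sumList {L : List (OpenTerm A)} {e : ℕ × Finset ℕ} :
    e ∈ firings (sumList L) ↔ ∃ t ∈ L, e ∈ firings t := by
  induction L using sumList.induct <;> simp_all [sumList, firings]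

theorem hasMollerSummand_sumList {Z : Finset ℕ} {L : List (OpenTerm A)} :
    HasMollerSummand Z (sumList L) ↔ ∃ t ∈ L, HasMollerSummand Z t := by
  induction L using sumList.induct with
  | case1 => exact iff_of_false (not_hasMollerSummand_of_vars_eq_empty rfl) (by simp)
  | case2 => simp [sumList]
  | case3 => simp_all [sumList, hasMollerSummand_plus]

theorem vars_sumTo_vz (n : ℕ) : vars (sumTo n vz : OpenTerm A) = Finset.Icc 2 (n + 1) := by
  ext v
  simp only [sumTo, mem_vars_sumList, List.mem_map, List.mem_range, vz]
  constructor
  · rintro ⟨_, ⟨i, hi, rfl⟩, hv⟩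
    simp only [vars, Finset.mem_singleton] at hv
    simp only [Finset.mem_Icc]
    omega
  · intro hv
    rw [Finset.mem_Icc] at hv
    exact ⟨_, ⟨v - 2, by omega, rfl⟩, by simp only [vars, Finset.mem_singleton]; omega⟩

theorem mem_firings_sumTo_vz {n v : ℕ} {S : Finset ℕ} :
    (v, S) ∈ firings (sumTo n vz : OpenTerm A) ↔ v ∈ Finset.Icc 2 (n + 1) ∧ S = ∅ := by
  have haf : ActionFree (sumTo n vz : OpenTerm A) := actionFree_sumList (by
    simp only [List.mem_map]
    rintro _ ⟨i, -, rfl⟩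
    trivial)
  have hd : depth (sumTo n vz : OpenTerm A) ≤ 1 := depth_sumList_le (by
    simp only [List.mem_map]
    rintro _ ⟨i, -, rfl⟩
    exact le_rfl)
  rw [haf.mem_firings_iff hd, vars_sumTo_vz]

theorem actionFree_moller (n : ℕ) : ActionFree (moller A n).1 := by
  refine ⟨⟨⟨trivial, trivial⟩, actionFree_sumList ?_⟩, actionFree_sumList ?_⟩ <;>
    simp only [List.mem_map] <;> rintro _ ⟨i, -, rfl⟩ <;> simp [ActionFree, vx, vy, vz]

theorem depth_moller_le (n : ℕ) : depth (moller A n).1 ≤ 2 := by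
  have h1 : depth (sumTo n vz : OpenTerm A) ≤ 1 := depth_sumList_le (by
    simp only [List.mem_map]
    rintro _ ⟨i, -, rfl⟩
    exact le_rfl)
  have h2 : depth (sumTo n fun i => .plus (.par vx (vz i)) (.par vy (vz i)) : OpenTerm A) ≤ 2 :=
    depth_sumList_le (by
      simp only [List.mem_map]
      rintro _ ⟨i, -, rfl⟩
      exact le_rfl)
  simp only [moller, depth, vx, vy] at *
  omega

theorem xGuarded_moller (n : ℕ) : XGuarded (Finset.Icc 2 (n + 1)) (moller A n).1 := by
  rintro S (hS | hS)
  · left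
    simpa [firings, vars, vx, vy, vars_sumTo_vz, mem_firings_sumTo_vz] using hS
  · right
    simp only [sumTo, mem_firings_sumList, List.mem_map] at hS
    obtain ⟨_, ⟨i, -, rfl⟩, hS⟩ := hS
    simp [firings, vars, vx, vy, vz] at hS
    simp [hS]

theorem hasMollerSummand_moller {n : ℕ} (hn : 1 ≤ n) :
    HasMollerSummand (Finset.Icc 2 (n + 1)) (moller A n).1 := by
  refine ⟨_, _, .plusLeft _ (.self (by simp [vars, vx, vy]) ?_), ?_, ?_⟩
  · rw [vars_sumTo_vz]
    exact ⟨2, by simp; omega⟩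
  · simp [firings, vars, vx, vy, vars_sumTo_vz]
  · refine .inr ⟨∅, ?_, by simp [vars, vx, vy]⟩
    simp only [mem_firings_sumTo_vz, Finset.mem_Icc]
    exact ⟨by omega, trivial⟩

/-- In `x ∥ ∑ zᵢ`, firing `z₁` leaves only `{x}`; in `y ∥ ∑ zᵢ`, `x` cannot fire; in `(x + y) ∥ zᵢ`,
firing `x` leaves one variable, which differs from `Z` because `n ≥ 2`. -/
theorem not_hasMollerSummand_moller {n : ℕ} (hn : 2 ≤ n) :
    ¬ HasMollerSummand (Finset.Icc 2 (n + 1)) (moller A n).2 := by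
  have hsum : vars (sumTo n vz : OpenTerm A) ≠ ∅ := by
    rw [vars_sumTo_vz]
    exact Finset.ne_empty_of_mem (a := 2) (by simp only [Finset.mem_Icc]; omega)
  simp only [moller, hasMollerSummand_plus, sumTo, hasMollerSummand_sumList, List.mem_map]
  rintro ((h | h) | ⟨_, ⟨i, -, rfl⟩, h⟩)
  · rcases hasMollerSummand_par.1 h with ⟨h, -⟩ | ⟨h, -⟩ | ⟨-, -, -, h⟩
    · exact hsum h
    · simp [vars, vx] at h
    · have : ({0, 1} : Finset ℕ).card = 1 := by
        rcases h with ⟨S, h, -⟩ | ⟨S, h, h'⟩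
        · simp [firings, vx] at h
        · have h := (mem_firings_sumTo_vz.1 h).2
          simp only [h, vars, vx, Finset.union_empty] at h'
          rw [h']; rfl
      simp at this
  · rcases hasMollerSummand_par.1 h with ⟨h, -⟩ | ⟨h, -⟩ | ⟨-, -, h, -⟩
    · exact hsum h
    · simp [vars, vy] at h
    · rcases h with ⟨S, h, -⟩ | ⟨S, h, -⟩
      · simp [firings, vy] at h
      · simpa using (mem_firings_sumTo_vz.1 h).1
  · rcases hasMollerSummand_par.1 h with ⟨h, -⟩ | ⟨h, -⟩ | ⟨-, -, h, -⟩
    · simp [vars, vz] at h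
    · simp [vars, vx, vy] at h
    · simp [firings, vars, vx, vy, vz] at h
      omega

end CCS

theorem mainTheorem2 {A : Type*} [Nonempty A] (E : Set (CCS.Equation A)) (hfin : E.Finite)
    (hsound : ∀ e ∈ E, CCS.SoundRWB e) :
    ∃ n : ℕ, 1 ≤ n ∧ ¬ CCS.Derivable E (CCS.moller A n).1 (CCS.moller A n).2 := by
  obtain ⟨b, hb⟩ := (hfin.image fun e => max (CCS.vars e.1).card (CCS.vars e.2).card).bddAbove
  -- `Z` has `b + 2` elements, more than any axiom has variables on either side, and `b + 2 ≥ 2` as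
  -- `not_hasMollerSummand_moller` demands.
  refine ⟨b + 2, by omega, fun h => ?_⟩
  have hr := h.related (Z := Finset.Icc 2 (b + 2 + 1)) hsound (by simp) (by simp) (fun e he => by
    have := hb (Set.mem_image_of_mem _ he)
    simp only [Nat.card_Icc]
    omega) .var
  rw [CCS.subst_var, CCS.subst_var] at hr
  exact CCS.not_hasMollerSummand_moller (by omega)
    ((hr.hasMollerSummand (CCS.actionFree_moller _) (CCS.depth_moller_le _)
      (CCS.xGuarded_moller _)).1 (CCS.hasMollerSummand_moller (by omega)))
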